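/- Let $\mathcal T$ be a finite tree with $n\ge 2$ vertices (the seed), let $m\ge 0$ be an integer, and let $\mathcal W_{\mathcal T}=\frac12\sum_{u,v}d_{uv}$ be its Wiener index, where $d_{uv}$ is the graph distance. Type-II growth of order $m$ turns a finite graph into the graph obtained by attaching $m k_u$ new leaves to each vertex $u$, where $k_u$ is the degree of $u$. Put $\mathcal T^{\mathrm{II}}_m(0)=\mathcal T$ and let $\mathcal T^{\mathrm{II}}_m(t)$ be the result of applying Type-II growth of order $m$ to $\mathcal T^{\mathrm{II}}_m(t-1)$, for $t\ge 1$; write $|\mathcal T^{\mathrm{II}}_m(t)|$ for its number of vertices. For a connected graph $\mathcal G$ with $N\ge 2$ vertices, let $\mathcal H_{u\to v}$ be the expected first time $k\ge 0$ at which the simple random walk started at $u$ (each step goes to a uniformly chosen neighbour) is at $v$, and let $\langle\mathcal H_{\mathcal G}\rangle=\frac{1}{N(N-1)}\sum_{u,v}\mathcal H_{u\to v}$ be the mean hitting time. Then for every integer $t\ge 0$ the graph $\mathcal T^{\mathrm{II}}_m(t)$ is a tree, $|\mathcal T^{\mathrm{II}}_m(t)|=(n-1)(2m+1)^t+1$,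 all its hitting times are finite, and $$\langle\mathcal H_{\mathcal T^{\mathrm{II}}_m(t)}\rangle=\frac{2}{|\mathcal T^{\mathrm{II}}_m(t)|}\Big\{f_2^{\,t}\,\mathcal W_{\mathcal T}+g_2\sum_{i=0}^{t-1}f_2^{\,i}\,|\mathcal T^{\mathrm{II}}_m(t-1-i)|^2-h_2\sum_{i=0}^{t-1}f_2^{\,i}\,|\mathcal T^{\mathrm{II}}_m(t-1-i)|+l_2\sum_{i=0}^{t-1}f_2^{\,i}\Big\},$$ where $f_2=(2m+1)^2$, $g_2=m(2m+1)$, $h_2=m(5m+3)$ and $l_2=m(3m+2)$. -/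

import Mathlib

open MeasureTheory ProbabilityTheory
open scoped ENNReal

universe u

/-- A finite simple graph, bundled with its vertex type. -/
structure FinGraph : Type (u + 1) where
  V : Type u
  [fintypeV : Fintype V]
  graph : SimpleGraph V

namespace FinGraph

instance (T : FinGraph.{u}) : Fintype T.V := T.fintypeV

/-- The vertex set is finite, so it carries the discrete σ-algebra. -/
instance (T : FinGraph.{u}) : MeasurableSpace T.V := ⊤

instance (T : FinGraph.{u}) : DiscreteMeasurableSpace T.V := ⟨fun _ => trivial⟩

/-- The number of vertices. -/
def order (T : FinGraph.{u}) : ℕ := Fintype.card T.V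

open Classical in
/-- The degree of a vertex. -/
noncomputable def deg (T : FinGraph.{u}) (u : T.V) : ℕ := T.graph.degree u

/-- The Wiener index: half the sum of the distances over all ordered pairs of vertices. -/
noncomputable def wiener (T : FinGraph.{u}) : ℝ :=
  (1 / 2) * ∑ u : T.V, ∑ v : T.V, (T.graph.dist u v : ℝ)

/-- Adjacency after attaching `m * deg u` new leaves to each vertex `u`. -/
inductive GrowAdj (m : ℕ) (T : FinGraph.{u}) :
    T.V ⊕ (Σ u : T.V, Fin (m * T.deg u)) → T.V ⊕ (Σ u : T.V, Fin (m * T.deg u)) → Prop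
  | old {u v : T.V} (h : T.graph.Adj u v) : GrowAdj m T (Sum.inl u) (Sum.inl v)
  | down (u : T.V) (i : Fin (m * T.deg u)) : GrowAdj m T (Sum.inl u) (Sum.inr ⟨u, i⟩)
  | up (u : T.V) (i : Fin (m * T.deg u)) : GrowAdj m T (Sum.inr ⟨u, i⟩) (Sum.inl u)

/-- The Type-II growth operation of order `m`: every vertex `u` of degree `k` receives `m * k`
new pendant vertices. -/
noncomputable def growII (m : ℕ) (T : FinGraph.{u}) : FinGraph.{u} where
  V := T.V ⊕ (Σ u : T.V, Fin (m * T.deg u))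
  graph :=
    { Adj := GrowAdj m T
      symm := by
        constructor
        intro a b h
        cases h with
        | old h => exact .old h.symm
        | down u i => exact .up u i
        | up u i => exact .down u i
      loopless := by
        constructor
        intro a h
        cases h with
        | old h => exact T.graph.loopless.irrefl _ h }

/-- The tree obtained from the seed `T` after `t` rounds of Type-II growth of order `m`. -/
noncomputable def treeII (m : ℕ) (T : FinGraph.{u}) : ℕ → FinGraph.{u}
  | 0 => T
  | t + 1 => growII m (treeII m T t)

open Classical in
/-- One step of the unbiased random walk: from `u` the walker moves to a uniformly chosen
neighbour. (At an isolated vertex, which does not occur in a tree with at least two vertices,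
the walker stays put.) -/
noncomputable def stepPMF (T : FinGraph.{u}) (u : T.V) : PMF T.V :=
  if h : (T.graph.neighborFinset u).Nonempty then
    PMF.uniformOfFinset (T.graph.neighborFinset u) h
  else PMF.pure u

/-- The transition kernel of the walk at time `k`: it depends on the history only through the
current position. -/
noncomputable def stepKernel (T : FinGraph.{u}) (k : ℕ) :
    Kernel (Π _ : Finset.Iic k, T.V) T.V where
  toFun x := (T.stepPMF (x ⟨k, Finset.mem_Iic.2 le_rfl⟩)).toMeasure
  measurable' := (measurable_of_countable fun u : T.V => (T.stepPMF u).toMeasure).comp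
    (measurable_pi_apply _)

instance (T : FinGraph.{u}) (k : ℕ) : IsMarkovKernel (T.stepKernel k) :=
  ⟨fun x => PMF.toMeasure.isProbabilityMeasure
    (T.stepPMF (x ⟨k, Finset.mem_Iic.2 le_rfl⟩))⟩

/-- The law, on the space of trajectories, of the unbiased random walk started at `u`. -/
noncomputable def walkLaw (T : FinGraph.{u}) (u : T.V) : Measure (ℕ → T.V) :=
  Kernel.trajMeasure (X := fun _ => T.V) (Measure.dirac u) T.stepKernel

/-- The hitting time from `u` to `v`: the expected value of the first time `k ≥ 0` at which the
walk started at `u` is at `v` (that time is `∞` on trajectories that never visit `v`). -/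
noncomputable def hittingTime (T : FinGraph.{u}) (u v : T.V) : ℝ≥0∞ :=
  ∫⁻ ω, (⨅ (k : ℕ) (_ : ω k = v), (k : ℝ≥0∞)) ∂(T.walkLaw u)

/-- The mean hitting time: the average of the hitting times over the `N (N - 1)` ordered pairs of
distinct vertices (the diagonal terms of the sum vanish, since the walk from `u` is at `u` at
time `0`). -/
noncomputable def meanHittingTime (T : FinGraph.{u}) : ℝ :=
  1 / ((T.order : ℝ) * ((T.order : ℝ) - 1)) *
    ∑ u : T.V, ∑ v : T.V, (T.hittingTime u v).toReal

end FinGraph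

/-! On a tree with `N` vertices the mean hitting time equals `2 / N` times the Wiener index, so the
claim reduces to how that index changes under growth.

For the reduction, `treeHit` is an explicit candidate for the hitting time. In a tree one neighbour
of `w ≠ z` is nearer to `z` and all others are farther, so the Laplacian of `dist z` at `w` is `deg
w - 2`, plus `2` if `w = z`. Hence `treeHit` solves the first-step equations, and
`hittingTime_eq_of_first_step` says that a finite solution is the hitting time. Summed over all
pairs, the bracket in `treeHit` loses its dependence on `w`, and `∑ deg = 2 (N - 1)` finishes.

Growth leaves distances between old vertices unchanged, and each new leaf endpoint adds `1` when the
endpoints are distinct. Leaves are attached in proportion to degree, so the new Wiener index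
involves only degree-weighted distance sums, which `IsTree.sum_degree_mul_dist` turns back into
plain ones. The resulting affine recursion `wiener_growII` is then iterated. -/

namespace FinGraph

/-! ### Random walk: hitting times from first-step equations -/

instance (T : FinGraph.{u}) (u : T.V) : IsProbabilityMeasure (T.walkLaw u) := by
  unfold walkLaw; infer_instance

/-- The walk started at `u` is at `u` at time `0`. -/
lemma lintegral_walkLaw_zero (T : FinGraph.{u}) (u : T.V) (g : T.V → ℝ≥0∞) :
    ∫⁻ ω, g (ω 0) ∂(T.walkLaw u) = g u := by
  have hmap : (T.walkLaw u).map (Preorder.frestrictLe 0) =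
      (Measure.dirac u).map (MeasurableEquiv.piUnique (fun _ : Finset.Iic 0 => T.V)).symm := by
    rw [walkLaw, Kernel.trajMeasure, Measure.map_comp _ _ (by fun_prop),
      Kernel.traj_map_frestrictLe, Kernel.partialTraj_self, Measure.id_comp]
  have h : ∫⁻ ω, g (ω 0) ∂(T.walkLaw u) = ∫⁻ x, g (x ⟨0, Finset.mem_Iic.2 le_rfl⟩)
      ∂((T.walkLaw u).map (Preorder.frestrictLe 0)) := by
    rw [lintegral_map (by fun_prop) (by fun_prop)]
    rfl
  rw [h, hmap, lintegral_map (by fun_prop) (by fun_prop), lintegral_dirac]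
  rfl

/-- The Markov property of the walk at time `n`. -/
lemma lintegral_walkLaw_succ (T : FinGraph.{u}) (u : T.V) (n : ℕ)
    {F : (Π _ : Finset.Iic n, T.V) → ℝ≥0∞} (hF : Measurable F) (g : T.V → ℝ≥0∞) :
    ∫⁻ ω, F (Preorder.frestrictLe n ω) * g (ω (n + 1)) ∂(T.walkLaw u) =
      ∫⁻ ω, F (Preorder.frestrictLe n ω) * ∫⁻ y, g y ∂(T.stepPMF (ω n)).toMeasure
        ∂(T.walkLaw u) := by
  have hg : Measurable g := measurable_of_countable g
  have key := Kernel.map_frestrictLe_trajMeasure_compProd_eq_map_trajMeasure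
    (X := fun _ => T.V) (μ₀ := Measure.dirac u) (κ := T.stepKernel) (a := n)
  have h1 : ∫⁻ ω, F (Preorder.frestrictLe n ω) * g (ω (n + 1)) ∂(T.walkLaw u) =
      ∫⁻ p, F p.1 * g p.2
        ∂((T.walkLaw u).map (fun x ↦ (Preorder.frestrictLe n x, x (n + 1)))) := by
    rw [lintegral_map (by fun_prop) (by fun_prop)]
  rw [h1, walkLaw, ← key, Measure.lintegral_compProd (by fun_prop),
    lintegral_map (Measurable.lintegral_kernel_prod_right' (f := fun p => F p.1 * g p.2)
      (by fun_prop)) (by fun_prop)]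
  refine lintegral_congr fun ω => ?_
  exact lintegral_const_mul (μ := (T.stepPMF (ω n)).toMeasure) (F (Preorder.frestrictLe n ω)) hg

/-- The trajectories that avoid `v` up to time `n`. -/
def avoiding (T : FinGraph.{u}) (v : T.V) (n : ℕ) : Set (ℕ → T.V) := {ω | ∀ k ≤ n, ω k ≠ v}

lemma measurableSet_avoiding (T : FinGraph.{u}) (v : T.V) (n : ℕ) :
    MeasurableSet (T.avoiding v n) := by
  have : T.avoiding v n = ⋂ k, ⋂ (_ : k ≤ n), (fun ω : ℕ → T.V => ω k) ⁻¹' {v}ᶜ := by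
    ext; simp [avoiding]
  rw [this]
  exact .iInter fun k => .iInter fun _ => measurable_pi_apply k (.of_discrete)

/-- Tail-sum formula: `v` is avoided up to time `n` exactly when `n` precedes the first visit.
Without a visit both sides are infinite. -/
lemma first_visit_eq_tsum (T : FinGraph.{u}) (v : T.V) (ω : ℕ → T.V) :
    (⨅ (k : ℕ) (_ : ω k = v), (k : ℝ≥0∞)) =
      ∑' n, (T.avoiding v n).indicator (fun _ => (1 : ℝ≥0∞)) ω := by
  classical
  by_cases hex : ∃ k, ω k = v
  · have hmem : ∀ n, ω ∈ T.avoiding v n ↔ n < Nat.find hex := fun n =>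
      (Nat.lt_find_iff hex n).symm
    have hL : (⨅ (k : ℕ) (_ : ω k = v), (k : ℝ≥0∞)) = (Nat.find hex : ℕ) :=
      le_antisymm (iInf₂_le (Nat.find hex) (Nat.find_spec hex))
        (le_iInf₂ fun k hk => Nat.cast_le.2 (Nat.find_min' hex hk))
    rw [hL, tsum_eq_sum (s := Finset.range (Nat.find hex))]
    · rw [Finset.sum_congr rfl (g := fun _ => 1) fun n hn => by
        rw [Set.indicator_of_mem ((hmem n).2 (Finset.mem_range.1 hn))]]
      simp
    · intro n hn
      rw [Set.indicator_of_notMem]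
      rwa [hmem, ← Finset.mem_range]
  · push Not at hex
    have hmem : ∀ n, ω ∈ T.avoiding v n := fun n k _ => hex k
    simp [hex, hmem]

lemma hittingTime_eq_tsum (T : FinGraph.{u}) (u v : T.V) :
    T.hittingTime u v = ∑' n, T.walkLaw u (T.avoiding v n) := by
  simp_rw [hittingTime, T.first_visit_eq_tsum]
  rw [lintegral_tsum fun n =>
    (measurable_const.indicator (T.measurableSet_avoiding v n)).aemeasurable]
  simp_rw [lintegral_indicator_const (T.measurableSet_avoiding v _), one_mul]

/-- One step of the walk stopped at `v`, for a solution `φ` of the first-step equations. -/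
lemma lintegral_avoiding_succ (T : FinGraph.{u}) (u v : T.V) (φ : T.V → ℝ≥0∞) (hv : φ v = 0)
    (hstep : ∀ w, w ≠ v → 1 + ∫⁻ y, φ y ∂(T.stepPMF w).toMeasure = φ w) (n : ℕ) :
    ∫⁻ ω in T.avoiding v n, φ (ω n) ∂(T.walkLaw u) =
      T.walkLaw u (T.avoiding v n) + ∫⁻ ω in T.avoiding v (n + 1), φ (ω (n + 1)) ∂(T.walkLaw u) := by
  classical
  -- The avoidance indicator as a function of the history up to time `n`, the form that the Markov
  -- property needs.
  let F : (Π _ : Finset.Iic n, T.V) → ℝ≥0∞ := fun x => if ∀ k, x k ≠ v then 1 else 0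
  have hF : Measurable F := measurable_of_countable F
  have hFA : ∀ ω : ℕ → T.V, F (Preorder.frestrictLe n ω) = (T.avoiding v n).indicator 1 ω := by
    intro ω
    have : (∀ k : Finset.Iic n, Preorder.frestrictLe (π := fun _ => T.V) n ω k ≠ v) ↔
        ω ∈ T.avoiding v n := by
      simp [avoiding, Subtype.forall]
    simp only [F, this, Set.indicator_apply, Pi.one_apply]
  have hM := T.lintegral_walkLaw_succ u n hF φ
  have hnext : ∫⁻ ω in T.avoiding v (n + 1), φ (ω (n + 1)) ∂(T.walkLaw u) =
      ∫⁻ ω, F (Preorder.frestrictLe n ω) * φ (ω (n + 1)) ∂(T.walkLaw u) := by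
    rw [← lintegral_indicator (T.measurableSet_avoiding v _)]
    refine lintegral_congr fun ω => ?_
    rw [hFA]
    -- Avoidance at time `n + 1` comes for free: a walk at `v` contributes `φ v = 0`.
    by_cases h1 : ω (n + 1) = v
    · have : ω ∉ T.avoiding v (n + 1) := fun h => h _ le_rfl h1
      simp [this, h1, hv]
    · have : ω ∈ T.avoiding v (n + 1) ↔ ω ∈ T.avoiding v n := by
        refine ⟨fun h k hk => h k (hk.trans n.le_succ), fun h k hk => ?_⟩
        rcases Nat.le_succ_iff.1 hk with hk | rfl
        exacts [h k hk, h1]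
      simp [Set.indicator_apply, this]
  rw [hnext, hM, ← lintegral_indicator_one (T.measurableSet_avoiding v n),
    ← lintegral_indicator (T.measurableSet_avoiding v n),
    ← lintegral_add_left (measurable_one.indicator (T.measurableSet_avoiding v n))]
  refine lintegral_congr fun ω => ?_
  rw [hFA]
  by_cases h : ω ∈ T.avoiding v n
  · simp [h, hstep _ (h n le_rfl)]
  · simp [h]

/-- A finite solution of the first-step equations is the hitting time. -/
theorem hittingTime_eq_of_first_step (T : FinGraph.{u}) (v : T.V) (φ : T.V → ℝ≥0∞)
    (hv : φ v = 0) (hfin : ∀ w, φ w ≠ ⊤)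
    (hstep : ∀ w, w ≠ v → 1 + ∫⁻ y, φ y ∂(T.stepPMF w).toMeasure = φ w) (u : T.V) :
    T.hittingTime u v = φ u := by
  let b : ℕ → ℝ≥0∞ := fun n => ∫⁻ ω in T.avoiding v n, φ (ω n) ∂(T.walkLaw u)
  have hb0 : b 0 = φ u := by
    have : b 0 = ∫⁻ ω, φ (ω 0) ∂(T.walkLaw u) := by
      simp only [b]
      rw [← lintegral_indicator (T.measurableSet_avoiding v _)]
      refine lintegral_congr fun ω => ?_
      by_cases h : ω 0 = v
      · simp [h, hv]
      · have : ω ∈ T.avoiding v 0 := fun k hk => by rwa [Nat.le_zero.1 hk]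
        simp [this]
    rw [this, T.lintegral_walkLaw_zero]
  have hsum : ∀ n, ∑ k ∈ Finset.range n, T.walkLaw u (T.avoiding v k) + b n = φ u := by
    intro n
    induction n with
    | zero => simpa using hb0
    | succ n ih =>
      rw [Finset.sum_range_succ, add_assoc, ← ih]
      congr 1
      exact (T.lintegral_avoiding_succ u v φ hv hstep n).symm
  have hle : ∑' n, T.walkLaw u (T.avoiding v n) ≤ φ u := by
    rw [ENNReal.tsum_eq_iSup_nat]
    exact iSup_le fun n => le_self_add.trans (hsum n).le
  have hlim := ENNReal.tendsto_atTop_zero_of_tsum_ne_top (ne_top_of_le_ne_top (hfin u) hle)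
  -- The remainder is at most `∑ w, φ w` times the probability of avoidance up to `n`, the general
  -- term of a convergent series.
  have hb : Filter.Tendsto b Filter.atTop (nhds 0) := by
    have hC : ∑ w, φ w ≠ ⊤ := ENNReal.sum_ne_top.2 fun w _ => hfin w
    have h0 := ENNReal.Tendsto.const_mul (a := ∑ w, φ w) hlim (Or.inr hC)
    rw [mul_zero] at h0
    refine tendsto_of_tendsto_of_tendsto_of_le_of_le tendsto_const_nhds h0
      (fun _ => zero_le) fun n => ?_
    calc b n ≤ ∫⁻ _ in T.avoiding v n, ∑ w, φ w ∂(T.walkLaw u) :=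
          lintegral_mono fun ω => Finset.single_le_sum (fun _ _ => zero_le) (Finset.mem_univ _)
      _ = _ := by rw [setLIntegral_const]
  have h2 := (ENNReal.tendsto_nat_tsum fun n => T.walkLaw u (T.avoiding v n)).add hb
  simp_rw [hsum, add_zero] at h2
  rw [T.hittingTime_eq_tsum]
  exact tendsto_nhds_unique h2 tendsto_const_nhds

lemma lintegral_stepPMF (T : FinGraph.{u}) (w : T.V) [Fintype (T.graph.neighborSet w)]
    (hw : 0 < T.graph.degree w) (g : T.V → ℝ≥0∞) :
    ∫⁻ y, g y ∂(T.stepPMF w).toMeasure =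
      (∑ y ∈ T.graph.neighborFinset w, g y) / T.graph.degree w := by
  classical
  have hne : (T.graph.neighborFinset w).Nonempty := by
    rwa [← Finset.card_pos, SimpleGraph.card_neighborFinset_eq_degree]
  rw [lintegral_fintype, stepPMF]
  simp_rw [PMF.toMeasure_apply_singleton _ _ (MeasurableSet.singleton _)]
  rw [dif_pos (by convert hne)]
  simp only [PMF.uniformOfFinset_apply, mul_ite, mul_zero]
  rw [ENNReal.div_eq_inv_mul, Finset.mul_sum, ← Finset.sum_filter]
  refine Finset.sum_congr (by ext; simp) fun y _ => ?_
  rw [mul_comm, ← SimpleGraph.card_neighborFinset_eq_degree]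
  congr!

end FinGraph

/-! ### Distance sums in trees -/

namespace SimpleGraph

variable {V : Type*} {G : SimpleGraph V}

/-- A function that changes by at most one along edges and vanishes at `z` is bounded by the
distance to `z`. -/
lemma Connected.le_dist_of_adj_le (hG : G.Connected) {f : V → ℕ} {z : V} (hz : f z = 0)
    (hf : ∀ x y, G.Adj x y → f x ≤ f y + 1) (x : V) : f x ≤ G.dist x z := by
  obtain ⟨p, hp⟩ := hG.exists_walk_length_eq_dist x z
  rw [← hp]
  clear hp
  induction p with
  | nil => simp [hz]
  | cons h p ih => exact (hf _ _ h).trans (by simpa using ih hz)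

/-- In a tree, exactly one neighbour of `w ≠ z` is closer to `z`. -/
lemma IsTree.existsUnique_adj_dist_add_one (hG : G.IsTree) {z w : V} (hne : w ≠ z) :
    ∃! x, G.Adj w x ∧ G.dist z x + 1 = G.dist z w := by
  obtain ⟨p, hp⟩ := hG.connected.exists_walk_length_eq_dist w z
  cases p with
  | nil => exact absurd rfl hne
  | @cons _ x _ h p =>
    refine ⟨x, ⟨h, ?_⟩, ?_⟩
    · have h1 := dist_le p
      rw [Walk.length_cons] at hp
      have := hG.dist_eq_dist_add_one_of_adj z h
      rw [dist_comm] at h1 hp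
      omega
    · rintro y ⟨hy, hd⟩
      obtain ⟨q, hq⟩ := hG.connected.exists_walk_length_eq_dist y z
      have hp' := Walk.isPath_of_length_eq_dist _ hp
      -- The walk through `y` is a geodesic too; paths in a tree are unique, so both have the same
      -- second vertex.
      have hq' : (Walk.cons hy q).IsPath := Walk.isPath_of_length_eq_dist _ <| by
        rw [Walk.length_cons, hq, dist_comm, hd, dist_comm]
      have := congrArg (fun r => r.1.snd) ((hG.isAcyclic.subsingleton_path w z).elim ⟨_, hp'⟩ ⟨_, hq'⟩)
      simpa using this.symm

variable [Fintype V] [DecidableRel G.Adj]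

/-- One neighbour is a step nearer to `z`, the other `deg w - 1` a step farther. A general `φ`
covers both distances and their squares. -/
lemma IsTree.sum_neighborFinset_dist (hG : G.IsTree) {z w : V} (hne : w ≠ z) (φ : ℕ → ℝ) :
    ∑ x ∈ G.neighborFinset w, φ (G.dist z x) =
      ((G.degree w : ℝ) - 1) * φ (G.dist z w + 1) + φ (G.dist z w - 1) := by
  classical
  obtain ⟨x, ⟨hx, hd⟩, huniq⟩ := hG.existsUnique_adj_dist_add_one hne
  have hmem : x ∈ G.neighborFinset w := by simpa using hx
  rw [← Finset.sum_erase_add _ _ hmem, ← hd, Nat.add_sub_cancel]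
  congr 1
  rw [Finset.sum_congr rfl (g := fun _ => φ (G.dist z x + 1 + 1)), Finset.sum_const,
    Finset.card_erase_of_mem hmem, card_neighborFinset_eq_degree, nsmul_eq_mul, Nat.cast_sub,
    Nat.cast_one]
  · rw [← card_neighborFinset_eq_degree]
    exact Finset.card_pos.2 ⟨x, hmem⟩
  · intro y hy
    rw [Finset.mem_erase, mem_neighborFinset] at hy
    rcases hG.dist_eq_dist_add_one_of_adj z hy.2 with h | h
    · exact absurd (huniq y ⟨hy.2, h.symm⟩) hy.1
    · rw [h, hd]

lemma sum_neighborFinset_dist_self (G : SimpleGraph V) [DecidableRel G.Adj] (w : V) (φ : ℕ → ℝ) :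
    ∑ x ∈ G.neighborFinset w, φ (G.dist w x) = (G.degree w : ℝ) * φ 1 := by
  rw [Finset.sum_congr rfl (g := fun _ => φ 1), Finset.sum_const, card_neighborFinset_eq_degree,
    nsmul_eq_mul]
  intro x hx
  rw [dist_eq_one_iff_adj.2 ((G.mem_neighborFinset _ _).1 hx)]

/-- The Laplacian of the distance to `z` in a tree. -/
lemma IsTree.sum_neighborFinset_dist_sub [DecidableEq V] (hG : G.IsTree) (z w : V) :
    ∑ x ∈ G.neighborFinset w, ((G.dist z x : ℝ) - G.dist z w) =
      (G.degree w : ℝ) - 2 + if w = z then 2 else 0 := by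
  split_ifs with h
  · subst h
    simpa using G.sum_neighborFinset_dist_self w (fun n => (n : ℝ))
  · have hpos : 1 ≤ G.dist z w := hG.connected.pos_dist_of_ne (Ne.symm h)
    rw [Finset.sum_sub_distrib, hG.sum_neighborFinset_dist h (fun n => (n : ℝ))]
    push_cast [hpos]
    rw [Finset.sum_const, card_neighborFinset_eq_degree, nsmul_eq_mul]
    ring

/-- The Laplacian of the squared distance to `z` in a tree. -/
lemma IsTree.sum_neighborFinset_dist_sq (hG : G.IsTree) (z w : V) :
    ∑ x ∈ G.neighborFinset w, (G.dist z x : ℝ) ^ 2 =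
      G.degree w * (G.dist z w : ℝ) ^ 2 + 2 * (G.degree w * G.dist z w) + G.degree w
        - 4 * G.dist z w := by
  by_cases h : w = z
  · subst h
    rw [G.sum_neighborFinset_dist_self w (fun n => (n : ℝ) ^ 2)]
    simp
  · have hpos : 1 ≤ G.dist z w := hG.connected.pos_dist_of_ne (Ne.symm h)
    rw [hG.sum_neighborFinset_dist h (fun n => (n : ℝ) ^ 2)]
    push_cast [hpos]
    ring

lemma sum_sum_neighborFinset (G : SimpleGraph V) [DecidableRel G.Adj] (φ : V → ℝ) :
    ∑ w, ∑ x ∈ G.neighborFinset w, φ x = ∑ x, (G.degree x : ℝ) * φ x := by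
  simp_rw [neighborFinset_eq_filter, Finset.sum_filter]
  rw [Finset.sum_comm]
  refine Finset.sum_congr rfl fun x _ => ?_
  simp_rw [G.adj_comm _ x]
  rw [← Finset.sum_filter, Finset.sum_const, ← neighborFinset_eq_filter,
    card_neighborFinset_eq_degree, nsmul_eq_mul]

lemma IsTree.sum_degree (hG : G.IsTree) :
    ∑ w, (G.degree w : ℝ) = 2 * ((Fintype.card V : ℝ) - 1) := by
  rw [← Nat.cast_sum, G.sum_degrees_eq_twice_card_edges, ← hG.card_edgeFinset]
  push_cast
  ring

/-- Summing the Laplacian of the squared distance over all `w` gives zero; the quadratic terms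
cancel, leaving a linear relation. -/
lemma IsTree.sum_degree_mul_dist (hG : G.IsTree) (z : V) :
    ∑ w, (G.degree w : ℝ) * G.dist z w =
      2 * ∑ w, (G.dist z w : ℝ) - ((Fintype.card V : ℝ) - 1) := by
  have h1 := G.sum_sum_neighborFinset (fun x => (G.dist z x : ℝ) ^ 2)
  simp_rw [hG.sum_neighborFinset_dist_sq, Finset.sum_sub_distrib, Finset.sum_add_distrib,
    ← Finset.mul_sum, hG.sum_degree] at h1
  linarith

end SimpleGraph

/-! ### Hitting times of trees and the Wiener index -/

namespace FinGraph

lemma sum_deg (T : FinGraph.{u}) (hT : T.graph.IsTree) :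
    ∑ w, (T.deg w : ℝ) = 2 * ((T.order : ℝ) - 1) := by
  classical
  exact hT.sum_degree

lemma sum_deg_mul_dist (T : FinGraph.{u}) (hT : T.graph.IsTree) (z : T.V) :
    ∑ w, (T.deg w : ℝ) * T.graph.dist z w =
      2 * ∑ w, (T.graph.dist z w : ℝ) - ((T.order : ℝ) - 1) := by
  classical
  exact hT.sum_degree_mul_dist z

/-- The closed form of the hitting times of a tree. -/
noncomputable def treeHit (T : FinGraph.{u}) (u v : T.V) : ℝ :=
  (1 / 2) * ∑ w, (T.deg w : ℝ) *
    ((T.graph.dist v u : ℝ) + T.graph.dist w v - T.graph.dist w u)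

lemma treeHit_nonneg (T : FinGraph.{u}) (hT : T.graph.IsTree) (u v : T.V) :
    0 ≤ T.treeHit u v := by
  refine mul_nonneg (by norm_num) (Finset.sum_nonneg fun w _ => mul_nonneg (by positivity) ?_)
  have : T.graph.dist w u ≤ T.graph.dist w v + T.graph.dist v u := hT.connected.dist_triangle
  have : (T.graph.dist w u : ℝ) ≤ T.graph.dist w v + T.graph.dist v u := by exact_mod_cast this
  linarith

lemma treeHit_self (T : FinGraph.{u}) (v : T.V) : T.treeHit v v = 0 := by
  simp [treeHit]

/-- The Laplacian of `treeHit` away from the target. -/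
lemma sum_treeHit_sub (T : FinGraph.{u}) (hT : T.graph.IsTree) [DecidableRel T.graph.Adj]
    {u v : T.V} (h : u ≠ v) :
    ∑ x ∈ T.graph.neighborFinset u, (T.treeHit x v - T.treeHit u v) = -T.deg u := by
  classical
  have hdiff : ∀ x, T.treeHit x v - T.treeHit u v = (1 / 2) * ∑ w, (T.deg w : ℝ) *
      (((T.graph.dist v x : ℝ) - T.graph.dist v u) -
        ((T.graph.dist w x : ℝ) - T.graph.dist w u)) := by
    intro x
    rw [treeHit, treeHit, ← mul_sub, ← Finset.sum_sub_distrib]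
    congr 1
    exact Finset.sum_congr rfl fun w _ => by ring
  simp_rw [hdiff, ← Finset.mul_sum]
  rw [Finset.sum_comm]
  simp_rw [← Finset.mul_sum, Finset.sum_sub_distrib (s := T.graph.neighborFinset u)
    (f := fun x => (T.graph.dist v x : ℝ) - T.graph.dist v u), hT.sum_neighborFinset_dist_sub,
    if_neg h]
  -- The two Laplacians cancel except for the point mass at `w = u`.
  have : ∀ w, (T.deg w : ℝ) * ((T.graph.degree u : ℝ) - 2 + 0 -
      ((T.graph.degree u : ℝ) - 2 + if u = w then 2 else 0)) =
      if u = w then -2 * (T.deg w : ℝ) else 0 := by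
    intro w
    split_ifs <;> ring
  simp_rw [this]
  rw [Finset.sum_ite_eq, if_pos (Finset.mem_univ _)]
  ring

theorem hittingTime_eq_treeHit (T : FinGraph.{u}) (hT : T.graph.IsTree) (u v : T.V) :
    T.hittingTime u v = ENNReal.ofReal (T.treeHit u v) := by
  classical
  refine T.hittingTime_eq_of_first_step v (fun w => ENNReal.ofReal (T.treeHit w v))
    (by simp [treeHit_self]) (fun _ => ENNReal.ofReal_ne_top) (fun w hw => ?_) u
  obtain ⟨x, ⟨hx, -⟩, -⟩ := hT.existsUnique_adj_dist_add_one hw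
  have hpos : 0 < T.graph.degree w := by
    rw [SimpleGraph.degree_pos_iff_exists_adj]
    exact ⟨x, hx⟩
  have hpos' : (0 : ℝ) < T.graph.degree w := by exact_mod_cast hpos
  have hsum := T.sum_treeHit_sub hT hw
  have hdeg : T.deg w = T.graph.degree w := rfl
  rw [Finset.sum_sub_distrib, Finset.sum_const, SimpleGraph.card_neighborFinset_eq_degree,
    nsmul_eq_mul, hdeg] at hsum
  have hnn := fun y => T.treeHit_nonneg hT y v
  rw [T.lintegral_stepPMF w hpos, ← ENNReal.ofReal_sum_of_nonneg fun y _ => hnn y,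
    ← ENNReal.ofReal_natCast (T.graph.degree w), ← ENNReal.ofReal_div_of_pos hpos',
    ← ENNReal.ofReal_one, ← ENNReal.ofReal_add zero_le_one
      (div_nonneg (Finset.sum_nonneg fun y _ => hnn y) hpos'.le)]
  congr 1
  field_simp
  linarith

theorem meanHittingTime_eq (T : FinGraph.{u}) (hT : T.graph.IsTree) (h2 : 2 ≤ T.order) :
    T.meanHittingTime = 2 / (T.order : ℝ) * T.wiener := by
  have hsum : ∑ u, ∑ v, T.treeHit u v =
      ((T.order : ℝ) - 1) * ∑ u, ∑ v, (T.graph.dist u v : ℝ) := by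
    -- The terms `dist w v` and `dist w u` have equal sums over all pairs.
    have hrow : ∀ w, ∑ u, ∑ v, ((T.graph.dist v u : ℝ) + T.graph.dist w v - T.graph.dist w u) =
        ∑ u, ∑ v, (T.graph.dist u v : ℝ) := by
      intro w
      simp only [Finset.sum_sub_distrib, Finset.sum_add_distrib, Finset.sum_const,
        ← Finset.smul_sum, add_sub_cancel_right]
      exact Finset.sum_comm
    calc ∑ u, ∑ v, T.treeHit u v
        = (1 / 2) * ∑ w, (T.deg w : ℝ) *
            ∑ u, ∑ v, ((T.graph.dist v u : ℝ) + T.graph.dist w v - T.graph.dist w u) := by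
          simp_rw [treeHit, ← Finset.mul_sum]
          congr 1
          simp_rw [Finset.mul_sum]
          rw [Finset.sum_comm' (t' := Finset.univ) (s' := fun _ => Finset.univ) (by simp)]
          rw [Finset.sum_congr rfl fun v _ => Finset.sum_comm, Finset.sum_comm]
          exact Finset.sum_congr rfl fun w _ => Finset.sum_comm
      _ = _ := by
          simp_rw [hrow, ← Finset.sum_mul, T.sum_deg hT]
          ring
  have h2' : (2 : ℝ) ≤ T.order := by exact_mod_cast h2
  have h1 : (T.order : ℝ) - 1 ≠ 0 := by linarith
  have h0 : (T.order : ℝ) ≠ 0 := by linarith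
  simp_rw [meanHittingTime, T.hittingTime_eq_treeHit hT,
    ENNReal.toReal_ofReal (T.treeHit_nonneg hT _ _), hsum, wiener]
  field_simp

end FinGraph

/-! ### Type-II growth: tree structure, distances, Wiener index -/

namespace FinGraph

variable {m : ℕ} {T : FinGraph.{u}}

/-- A vertex of the original graph, as a vertex of the grown graph. -/
def oldV (m : ℕ) {T : FinGraph.{u}} (u : T.V) : (growII m T).V := Sum.inl u

/-- A new leaf attached to `u`. -/
def leafV {m : ℕ} {T : FinGraph.{u}} (u : T.V) (i : Fin (m * T.deg u)) : (growII m T).V :=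
  Sum.inr ⟨u, i⟩

lemma forall_growII {p : (growII m T).V → Prop} (hold : ∀ u, p (oldV m u))
    (hleaf : ∀ u i, p (leafV u i)) (a : (growII m T).V) : p a := by
  rcases a with u | ⟨u, i⟩
  exacts [hold u, hleaf u i]

lemma leafV_eq_leafV_iff {u v : T.V} {i : Fin (m * T.deg u)} {j : Fin (m * T.deg v)} :
    leafV u i = leafV v j ↔ (⟨u, i⟩ : Σ u : T.V, Fin (m * T.deg u)) = ⟨v, j⟩ :=
  Sum.inr_injective.eq_iff

lemma oldV_ne_leafV (u v : T.V) (j : Fin (m * T.deg v)) : oldV m u ≠ leafV v j :=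
  Sum.inl_ne_inr

lemma sum_growII (f : (growII m T).V → ℝ) :
    ∑ a, f a = ∑ u, f (oldV m u) + ∑ u, ∑ i : Fin (m * T.deg u), f (leafV u i) :=
  (Fintype.sum_sum_type f).trans (by rw [Fintype.sum_sigma]; rfl)

lemma order_growII (hT : T.graph.IsTree) :
    ((growII m T).order : ℝ) = T.order + 2 * m * ((T.order : ℝ) - 1) := by
  have h := sum_growII (m := m) (T := T) (fun _ => 1)
  simp only [Finset.sum_const, Finset.card_univ, Fintype.card_fin, nsmul_eq_mul, mul_one,
    Nat.cast_mul, ← Finset.mul_sum, T.sum_deg hT] at h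
  rw [order, h, order]
  ring

lemma growII_adj_old_old {u v : T.V} :
    (growII m T).graph.Adj (oldV m u) (oldV m v) ↔ T.graph.Adj u v :=
  ⟨fun h => by cases h; assumption, fun h => .old h⟩

lemma growII_adj_old_leaf {u v : T.V} {i : Fin (m * T.deg v)} :
    (growII m T).graph.Adj (oldV m u) (leafV v i) ↔ u = v :=
  ⟨fun h => by cases h; rfl, fun h => by subst h; exact .down u i⟩

lemma growII_adj_leaf_old {u v : T.V} {i : Fin (m * T.deg u)} :
    (growII m T).graph.Adj (leafV u i) (oldV m v) ↔ u = v :=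
  ⟨fun h => by cases h; rfl, fun h => by subst h; exact .up u i⟩

lemma not_growII_adj_leaf_leaf (u v : T.V) (i : Fin (m * T.deg u)) (j : Fin (m * T.deg v)) :
    ¬ (growII m T).graph.Adj (leafV u i) (leafV v j) := by
  intro h; cases h

/-- The embedding of a graph into the grown graph. -/
def growIIHom (m : ℕ) (T : FinGraph.{u}) : T.graph →g (growII m T).graph where
  toFun := oldV m
  map_rel' h := .old h

lemma connected_growII (hT : T.graph.Connected) : (growII m T).graph.Connected := by
  obtain ⟨z⟩ := hT.nonempty
  have hinl : ∀ u : T.V, (growII m T).graph.Reachable (oldV m u) (oldV m z) := fun u =>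
    (hT u z).map (growIIHom m T)
  have hz : ∀ a, (growII m T).graph.Reachable a (oldV m z) := by
    refine forall_growII hinl fun u i => ?_
    exact (SimpleGraph.Adj.reachable (growII_adj_leaf_old.2 rfl)).trans (hinl u)
  exact { preconnected := fun a b => (hz a).trans (hz b).symm, nonempty := ⟨oldV m z⟩ }

lemma deg_eq_sum (T : FinGraph.{u}) [DecidableRel T.graph.Adj] (u : T.V) :
    (T.deg u : ℝ) = ∑ v, if T.graph.Adj u v then 1 else 0 := by
  rw [Finset.sum_boole, deg, ← SimpleGraph.card_neighborFinset_eq_degree]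
  congr 2
  ext; simp

/-- Old degrees are multiplied by `m + 1` and leaves have degree `1`. This is the edge count by
which the connected grown graph is recognised as a tree. -/
lemma sum_deg_growII (hT : T.graph.IsTree) :
    ∑ a, ((growII m T).deg a : ℝ) = 2 * (((growII m T).order : ℝ) - 1) := by
  classical
  have hinl : ∀ u : T.V, ((growII m T).deg (oldV m u) : ℝ) = T.deg u + m * T.deg u := by
    intro u
    rw [deg_eq_sum, sum_growII]
    simp only [growII_adj_old_old, growII_adj_old_leaf, ← deg_eq_sum]
    simp
  have hinr : ∀ (u : T.V) i, ((growII m T).deg (leafV u i) : ℝ) = 1 := by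
    intro u i
    rw [deg_eq_sum, sum_growII]
    simp only [growII_adj_leaf_old, not_growII_adj_leaf_leaf]
    simp
  rw [sum_growII, order_growII hT]
  simp_rw [hinl, hinr]
  simp only [Finset.sum_const, Finset.card_univ, Fintype.card_fin, nsmul_eq_mul, mul_one,
    Nat.cast_mul, ← Finset.mul_sum, T.sum_deg hT, Finset.sum_add_distrib]
  ring

theorem isTree_growII (hT : T.graph.IsTree) : (growII m T).graph.IsTree := by
  classical
  rw [SimpleGraph.isTree_iff_connected_and_card]
  refine ⟨connected_growII hT.connected, ?_⟩
  have h1 := sum_deg_growII (m := m) hT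
  have h2 : ∑ a, (growII m T).deg a = _ := (growII m T).graph.sum_degrees_eq_twice_card_edges
  rw [← Nat.cast_sum, h2, order] at h1
  rw [Nat.card_eq_fintype_card, Nat.card_eq_fintype_card, ← SimpleGraph.edgeFinset_card]
  have h3 : (((growII m T).graph.edgeFinset.card + 1 : ℕ) : ℝ) =
      (Fintype.card (growII m T).V : ℕ) := by
    push_cast at h1 ⊢
    linarith
  exact_mod_cast h3

lemma dist_growII_old_le (hT : T.graph.Connected) (u v : T.V) :
    (growII m T).graph.dist (oldV m u) (oldV m v) ≤ T.graph.dist u v := by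
  obtain ⟨p, hp⟩ := hT.exists_walk_length_eq_dist u v
  rw [← hp, ← p.length_map (growIIHom m T)]
  exact SimpleGraph.dist_le _

/-- The distance in the grown graph from `a` to the old vertex `v`. -/
noncomputable def heightTo (T : FinGraph.{u}) (m : ℕ) (v : T.V) : (growII m T).V → ℕ :=
  Sum.elim (fun u => T.graph.dist u v) (fun p => T.graph.dist p.1 v + 1)

lemma heightTo_old (u v : T.V) : T.heightTo m v (oldV m u) = T.graph.dist u v := rfl

lemma heightTo_leaf (u v : T.V) (i : Fin (m * T.deg u)) :
    T.heightTo m v (leafV u i) = T.graph.dist u v + 1 := rfl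

lemma heightTo_le_of_adj (hT : T.graph.Connected) (v : T.V) {a b : (growII m T).V}
    (h : (growII m T).graph.Adj a b) : T.heightTo m v a ≤ T.heightTo m v b + 1 := by
  cases h with
  | @old x y h =>
    have h1 : T.graph.dist x v ≤ T.graph.dist x y + T.graph.dist y v := hT.dist_triangle
    rw [SimpleGraph.dist_eq_one_iff_adj.2 h] at h1
    change T.graph.dist x v ≤ T.graph.dist y v + 1
    omega
  | down u i =>
    change T.graph.dist u v ≤ T.graph.dist u v + 1 + 1
    omega
  | up u i => exact le_rfl

/-- The upper bound is the triangle inequality; the lower one holds because `heightTo` vanishes at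
the target and changes by at most one along edges. -/
lemma dist_growII_old (hT : T.graph.Connected) (a : (growII m T).V) (v : T.V) :
    (growII m T).graph.dist a (oldV m v) = T.heightTo m v a := by
  refine le_antisymm ?_ ((connected_growII hT).le_dist_of_adj_le
    (by simp [heightTo_old]) (fun x y h => heightTo_le_of_adj hT v h) a)
  revert a
  refine forall_growII (fun u => dist_growII_old_le hT u v) fun u i => ?_
  have h1 : (growII m T).graph.dist (leafV u i) (oldV m v) ≤ _ :=
    (connected_growII hT).dist_triangle (v := oldV m u)
  rw [SimpleGraph.dist_eq_one_iff_adj.2 (growII_adj_leaf_old.2 rfl)] at h1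
  have := dist_growII_old_le (m := m) hT u v
  rw [heightTo_leaf]
  omega

lemma dist_growII_leaf (hT : T.graph.Connected) {a : (growII m T).V} {v : T.V}
    {j : Fin (m * T.deg v)} (ha : a ≠ leafV v j) :
    (growII m T).graph.dist a (leafV v j) = T.heightTo m v a + 1 := by
  classical
  apply le_antisymm
  · have h1 : (growII m T).graph.dist a (leafV v j) ≤ _ :=
      (connected_growII hT).dist_triangle (v := oldV m v)
    rwa [SimpleGraph.dist_eq_one_iff_adj.2 (growII_adj_old_leaf.2 rfl), dist_growII_old hT] at h1
  · have h := (connected_growII (m := m) hT).le_dist_of_adj_le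
      -- Resetting the value to `0` at the leaf respects the one-step bound: its only neighbour
      -- `oldV m v` has value `1`.
      (f := fun b => if b = leafV v j then 0 else T.heightTo m v b + 1)
      (z := leafV v j) (by simp) ?_ a
    · simpa [ha] using h
    · intro x y hxy
      by_cases hx : x = leafV v j
      · simp [hx]
      · by_cases hy : y = leafV v j
        · subst hy
          have : x = oldV m v := by
            clear hx
            revert x
            refine forall_growII (fun u h => by rw [growII_adj_old_leaf.1 h]) fun u i h => ?_
            exact absurd h (not_growII_adj_leaf_leaf _ _ _ _)
          simp [this, heightTo_old, oldV_ne_leafV]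
        · simp only [hx, hy, if_false]
          have := heightTo_le_of_adj hT v hxy
          omega

theorem wiener_growII (hT : T.graph.IsTree) :
    (growII m T).wiener = (2 * (m : ℝ) + 1) ^ 2 * T.wiener
      + (m : ℝ) * (2 * m + 1) * (T.order : ℝ) ^ 2 - (m : ℝ) * (5 * m + 3) * T.order
      + (m : ℝ) * (3 * m + 2) := by
  classical
  have hc := hT.connected
  -- The general formula assigns a leaf distance `2` to itself instead of `0`; this is the
  -- correction.
  let leafTerm : (growII m T).V → ℝ := Sum.elim (fun _ => 0) (fun _ => 2)
  have hterm_old : ∀ u : T.V, leafTerm (oldV m u) = 0 := fun _ => rfl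
  have hterm_leaf : ∀ (u : T.V) i, leafTerm (leafV u i) = 2 := fun _ _ => rfl
  have hrow : ∀ a, ∑ b, ((growII m T).graph.dist a b : ℝ) =
      ∑ v, (T.heightTo m v a : ℝ) + ∑ v, (m * T.deg v : ℝ) * ((T.heightTo m v a : ℝ) + 1)
        - leafTerm a := by
    refine forall_growII (fun u => ?_) fun u i => ?_ <;> rw [sum_growII] <;>
      simp_rw [dist_growII_old hc]
    · have h1 : ∀ v (j : Fin (m * T.deg v)),
          ((growII m T).graph.dist (oldV m u) (leafV v j) : ℝ) =
            (T.heightTo m v (oldV m u) : ℝ) + 1 := by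
        intro v j
        rw [dist_growII_leaf hc (oldV_ne_leafV u v j)]
        push_cast; rfl
      simp_rw [h1, hterm_old]
      simp only [Finset.sum_const, Finset.card_univ, Fintype.card_fin, nsmul_eq_mul, Nat.cast_mul,
        sub_zero]
    · have h1 : ∀ v (j : Fin (m * T.deg v)),
          ((growII m T).graph.dist (leafV u i) (leafV v j) : ℝ) =
            (T.heightTo m v (leafV u i) : ℝ) + 1 -
              if (⟨v, j⟩ : Σ u : T.V, Fin (m * T.deg u)) = ⟨u, i⟩ then 2 else 0 := by
        intro v j
        split_ifs with h
        · obtain rfl : v = u := congrArg Sigma.fst h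
          rw [leafV_eq_leafV_iff.2 h]
          simp only [heightTo_leaf, SimpleGraph.dist_self]
          norm_num
        · rw [dist_growII_leaf hc (fun h' => h (leafV_eq_leafV_iff.1 h').symm)]
          push_cast; ring
      have h2 : ∑ v, ∑ j : Fin (m * T.deg v),
          (if (⟨v, j⟩ : Σ u : T.V, Fin (m * T.deg u)) = ⟨u, i⟩ then (2 : ℝ) else 0) = 2 := by
        rw [← Fintype.sum_sigma' (fun v j =>
          if (⟨v, j⟩ : Σ u : T.V, Fin (m * T.deg u)) = ⟨u, i⟩ then (2 : ℝ) else 0)]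
        simp
      simp_rw [h1, Finset.sum_sub_distrib, h2, hterm_leaf]
      simp only [Finset.sum_const, Finset.card_univ, Fintype.card_fin, nsmul_eq_mul, Nat.cast_mul]
      ring
  set D : ℝ := ∑ u, ∑ v, (T.graph.dist u v : ℝ) with hD
  have hdeg := T.sum_deg hT
  have hS : ∀ u, ∑ v, (T.deg v : ℝ) * T.graph.dist u v =
      2 * ∑ v, (T.graph.dist u v : ℝ) - ((T.order : ℝ) - 1) := T.sum_deg_mul_dist hT
  have hcard : ∑ _u : T.V, (1 : ℝ) = T.order := by simp [order]
  set N : ℝ := (T.order : ℝ)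
  -- By symmetry of the distance, this is `hS` summed over all base points.
  have hSS : ∑ u, (T.deg u : ℝ) * ∑ v, (T.graph.dist u v : ℝ) = 2 * D - N * (N - 1) := by
    calc ∑ u, (T.deg u : ℝ) * ∑ v, (T.graph.dist u v : ℝ)
        = ∑ v, ∑ u, (T.deg u : ℝ) * T.graph.dist v u := by
          simp_rw [Finset.mul_sum]
          rw [Finset.sum_comm]
          simp_rw [SimpleGraph.dist_comm]
      _ = _ := by
          simp_rw [hS, Finset.sum_sub_distrib, ← Finset.mul_sum, ← hD]
          rw [← hcard, Finset.sum_mul]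
          simp
  have hinl : ∀ u : T.V, ∑ b, ((growII m T).graph.dist (oldV m u) b : ℝ) =
      (2 * m + 1) * ∑ v, (T.graph.dist u v : ℝ) + m * (N - 1) := by
    intro u
    rw [hrow]
    simp only [heightTo_old, hterm_old]
    have : ∑ v, (m * T.deg v : ℝ) * ((T.graph.dist u v : ℝ) + 1) =
        m * (∑ v, (T.deg v : ℝ) * T.graph.dist u v + ∑ v, (T.deg v : ℝ)) := by
      rw [← Finset.sum_add_distrib, Finset.mul_sum]
      exact Finset.sum_congr rfl fun v _ => by ring
    rw [this, hS, hdeg]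
    ring
  have hinr : ∀ (u : T.V) i, ∑ b, ((growII m T).graph.dist (leafV u i) b : ℝ) =
      (2 * m + 1) * ∑ v, (T.graph.dist u v : ℝ) + N + 3 * m * (N - 1) - 2 := by
    intro u i
    rw [hrow]
    simp only [heightTo_leaf, hterm_leaf]
    have : ∑ v, (m * T.deg v : ℝ) * (((T.graph.dist u v + 1 : ℕ) : ℝ) + 1) =
        m * (∑ v, (T.deg v : ℝ) * T.graph.dist u v + 2 * ∑ v, (T.deg v : ℝ)) := by
      rw [Finset.mul_sum, ← Finset.sum_add_distrib, Finset.mul_sum]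
      exact Finset.sum_congr rfl fun v _ => by push_cast; ring
    rw [this, hS, hdeg]
    simp only [Nat.cast_add, Nat.cast_one, Finset.sum_add_distrib, hcard]
    ring
  have hleaf : ∑ u, ∑ i : Fin (m * T.deg u),
      ∑ b, ((growII m T).graph.dist (leafV u i) b : ℝ) =
      m * ((2 * m + 1) * (2 * D - N * (N - 1)) + (N + 3 * m * (N - 1) - 2) * (2 * (N - 1))) := by
    simp_rw [hinr]
    rw [← hSS, ← hdeg, Finset.mul_sum, Finset.mul_sum, ← Finset.sum_add_distrib, Finset.mul_sum]
    refine Finset.sum_congr rfl fun u _ => ?_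
    simp only [Finset.sum_const, Finset.card_univ, Fintype.card_fin, nsmul_eq_mul, Nat.cast_mul]
    ring
  have hold : ∑ u : T.V, ∑ b, ((growII m T).graph.dist (oldV m u) b : ℝ) =
      (2 * m + 1) * D + m * (N - 1) * N := by
    simp_rw [hinl]
    rw [Finset.sum_add_distrib, ← Finset.mul_sum, ← hcard, Finset.mul_sum]
    simp
    ring
  rw [wiener, sum_growII, hold, hleaf, wiener, ← hD]
  ring

/-! ### Iterating the growth -/

theorem isTree_treeII (hT : T.graph.IsTree) (t : ℕ) : (T.treeII m t).graph.IsTree := by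
  induction t with
  | zero => exact hT
  | succ t ih => exact isTree_growII ih

theorem order_treeII (hT : T.graph.IsTree) (t : ℕ) :
    ((T.treeII m t).order : ℝ) = ((T.order : ℝ) - 1) * (2 * (m : ℝ) + 1) ^ t + 1 := by
  induction t with
  | zero => simp [treeII]
  | succ t ih =>
    rw [treeII, order_growII (isTree_treeII hT t), ih]
    ring

theorem wiener_treeII (hT : T.graph.IsTree) {f g h l : ℝ}
    (hf : f = (2 * (m : ℝ) + 1) ^ 2) (hg : g = (m : ℝ) * (2 * m + 1))
    (hh : h = (m : ℝ) * (5 * m + 3)) (hl : l = (m : ℝ) * (3 * m + 2)) (t : ℕ) :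
    (T.treeII m t).wiener =
      f ^ t * T.wiener
        + g * ∑ i ∈ Finset.range t, f ^ i * ((T.treeII m (t - 1 - i)).order : ℝ) ^ 2
        - h * ∑ i ∈ Finset.range t, f ^ i * ((T.treeII m (t - 1 - i)).order : ℝ)
        + l * ∑ i ∈ Finset.range t, f ^ i := by
  induction t with
  | zero => simp [treeII]
  | succ t ih =>
    -- The term `i = 0` is the newest, `F t`; shifting the others takes out one factor `f`, matching
    -- the recursion.
    have hshift : ∀ F : ℕ → ℝ, ∑ i ∈ Finset.range (t + 1), f ^ i * F (t + 1 - 1 - i) =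
        f * ∑ i ∈ Finset.range t, f ^ i * F (t - 1 - i) + F t := by
      intro F
      rw [Finset.sum_range_succ', Finset.mul_sum]
      congr 1
      · refine Finset.sum_congr rfl fun i _ => ?_
        rw [show t + 1 - 1 - (i + 1) = t - 1 - i by omega]
        ring
      · simp
    have h1 := hshift (fun k => ((T.treeII m k).order : ℝ) ^ 2)
    have h2 := hshift (fun k => ((T.treeII m k).order : ℝ))
    have h3 := hshift (fun _ => 1)
    simp only [mul_one] at h3
    rw [h1, h2, h3, treeII, wiener_growII (isTree_treeII hT t), ih, hf, hg, hh, hl]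
    ring

end FinGraph

theorem propositionI10 (T : FinGraph.{u}) (hT : T.graph.IsTree) (n : ℕ) (hn : T.order = n)
    (hn2 : 2 ≤ n) (m : ℕ) (f g h l : ℝ)
    (hf : f = (2 * (m : ℝ) + 1) ^ 2) (hg : g = (m : ℝ) * (2 * m + 1))
    (hh : h = (m : ℝ) * (5 * m + 3)) (hl : l = (m : ℝ) * (3 * m + 2)) (t : ℕ) :
    (T.treeII m t).graph.IsTree ∧
    ((T.treeII m t).order : ℝ) = ((n : ℝ) - 1) * (2 * (m : ℝ) + 1) ^ t + 1 ∧
    (∀ u v : (T.treeII m t).V, (T.treeII m t).hittingTime u v ≠ ⊤) ∧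
    (T.treeII m t).meanHittingTime =
      2 / ((T.treeII m t).order : ℝ) *
        (f ^ t * T.wiener
          + g * ∑ i ∈ Finset.range t, f ^ i * ((T.treeII m (t - 1 - i)).order : ℝ) ^ 2
          - h * ∑ i ∈ Finset.range t, f ^ i * ((T.treeII m (t - 1 - i)).order : ℝ)
          + l * ∑ i ∈ Finset.range t, f ^ i) := by
  subst hn
  have htree := FinGraph.isTree_treeII (m := m) hT t
  have horder := FinGraph.order_treeII (m := m) hT t
  -- This keeps the normalising factor `N (N - 1)` nonzero.
  have h2 : 2 ≤ (T.treeII m t).order := by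
    have hN : (2 : ℝ) ≤ T.order := by exact_mod_cast hn2
    have hpow : (1 : ℝ) ≤ (2 * (m : ℝ) + 1) ^ t :=
      one_le_pow₀ (by linarith [Nat.cast_nonneg (α := ℝ) m])
    have : (2 : ℝ) ≤ (T.treeII m t).order := by
      rw [horder]
      nlinarith
    exact_mod_cast this
  refine ⟨htree, horder, fun u v => ?_, ?_⟩
  · rw [FinGraph.hittingTime_eq_treeHit _ htree]
    exact ENNReal.ofReal_ne_top
  · rw [FinGraph.meanHittingTime_eq _ htree h2, FinGraph.wiener_treeII hT hf hg hh hl]
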